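/- Let $V$ be a finite set of factors, let $\mathcal I_\gamma$ ($\gamma\in V$) be a finite set of levels with a distinguished level $0$, and let $\mathcal I=\prod_{\gamma\in V}\mathcal I_\gamma$ be the set of cells, with $i^*=(0,\dots,0)$. A hierarchical log-linear model is given by a family $\mathcal D$ of nonempty subsets of $V$ that contains, with each of its members, every nonempty subset of that member. For $D\in\mathcal D$ let $\mathcal I_D^*=\prod_{\gamma\in D}(\mathcal I_\gamma\setminus\{0\})$; for $j\in\mathcal I$ let $j_D=(j_\gamma)_{\gamma\in D}$ and $\mathcal D_j^*=\{D\in\mathcal D: j_\gamma\neq 0\text{ for all }\gamma\in D\}$. Let $J=\{(D,i_D): D\in\mathcal D,\ i_D\in\mathcal I_D^*\}$ and assume that $J\neq\emptyset$, that is, that the model has at least one free parameter. For $\theta=(\theta_D(i_D))_{(D,i_D)\in J}\in\mathbb R^{J}$ put $$Z(\theta)=1+\sum_{i\in\mathcal I,\ i\ne i^*}\exp\sum_{D\in\mathcal D_i^*}\theta_D(i_D),\qquad p_\theta(j)=\frac{\exp\sum_{D\in\mathcal D_j^*}\theta_D(j_D)}{Z(\theta)}\quad(j\in\mathcal I).$$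 For $s=(s(i_D))_{(D,i_D)\in J}\in\mathbb R^{J}$ and $\alpha\in\mathbb R$, the Diaconis–Ylvisaker conjugate prior $\pi_G(\theta\mid s,\alpha)$ is the prior on $\mathbb R^{J}$ whose density with respect to Lebesgue measure is proportional to $$\exp\Big\{\sum_{D\in\mathcal D}\sum_{i_D\in\mathcal I_D^*}\theta_D(i_D)\,s(i_D)-\alpha\log Z(\theta)\Big\};$$ it is called proper if the integral of this function over $\mathbb R^{J}$ is finite. **Lemma 3.1.** The prior $\pi_G(\theta\mid s,\alpha)$ is proper if and only if $\alpha>0$ and $s/\alpha$ lies in the mean space of the model, that is, if and only if $\alpha>0$ and there is a $\theta\in\mathbb R^{J}$ such that $$\frac{s(i_D)}{\alpha}=\sum_{j\in\mathcal I,\ j_D=i_D}p_\theta(j)\qquad\text{for all } D\in\mathcal D,\ i_D\in\mathcal I_D^*.$$ -/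

import Mathlib

open scoped ENNReal

/-- A hierarchical log-linear model on a set `V` of factors, given by the family of all
interactions which it allows: nonempty subsets of `V`, such that with an interaction every
nonempty subset of it is allowed as well. -/
structure HierarchicalModel (V : Type*) where
  /-- The family `𝒟` of the interactions of the model. -/
  interactions : Finset (Finset V)
  nonempty_of_mem : ∀ D ∈ interactions, D.Nonempty
  mem_of_subset : ∀ D ∈ interactions, ∀ E ⊆ D, E.Nonempty → E ∈ interactions

namespace HierarchicalModel

noncomputable section

/-- The index set of the free log-linear parameters: the pairs `(D, i_D)` where `D` is an
interaction of the model and `i_D` is a cell of the `D`-marginal table no coordinate of which is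
the reference level `0`. Here `L γ` is the set of levels of the factor `γ`. -/
abbrev ParamIndex {V : Type*} (M : HierarchicalModel V) (L : V → Type*) [∀ γ, Zero (L γ)] :
    Type _ :=
  (D : {D // D ∈ M.interactions}) × ((γ : {γ // γ ∈ D.1}) → {x : L γ.1 // x ≠ 0})

section

variable {V : Type*} [Fintype V] [DecidableEq V] (M : HierarchicalModel V)
  {L : V → Type*} [∀ γ, Fintype (L γ)] [∀ γ, DecidableEq (L γ)] [∀ γ, Zero (L γ)]

/-- `∑ θ_D(j_D)` over the interactions `D` of the model such that `j_γ ≠ 0` for all `γ ∈ D`. -/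
def logit (θ : M.ParamIndex L → ℝ) (j : ∀ γ, L γ) : ℝ :=
  ∑ D : {D // D ∈ M.interactions},
    if h : ∀ γ : {γ // γ ∈ D.1}, j γ.1 ≠ 0 then θ ⟨D, fun γ => ⟨j γ.1, h γ⟩⟩ else 0

/-- `1 + ∑ exp (∑ θ_D(i_D))`, where the outer sum is over the cells `i` other than the reference
cell `(0, …, 0)`. -/
def partitionFn (θ : M.ParamIndex L → ℝ) : ℝ :=
  1 + ∑ i ∈ Finset.univ.filter (fun i : ∀ γ, L γ => i ≠ 0), Real.exp (M.logit θ i)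

/-- The probability `p(i)` of the cell `i` under the parameter `θ`. -/
def cellProb (θ : M.ParamIndex L → ℝ) (i : ∀ γ, L γ) : ℝ :=
  Real.exp (M.logit θ i) / M.partitionFn θ

/-- The marginal probability `∑ p(j)` over all cells `j` with `j_D = i_D`, for an index
`k = (D, i_D)`. -/
def marginalProb (θ : M.ParamIndex L → ℝ) (k : M.ParamIndex L) : ℝ :=
  ∑ j ∈ Finset.univ.filter
    (fun j : ∀ γ, L γ => ∀ γ : {γ // γ ∈ k.1.1}, j γ.1 = (k.2 γ).1), M.cellProb θ j

/-- The Diaconis–Ylvisaker conjugate prior density of `θ` with hyperparameters `(s, α)`, without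
the normalising constant. -/
def priorKernel (s : M.ParamIndex L → ℝ) (α : ℝ) (θ : M.ParamIndex L → ℝ) : ℝ :=
  Real.exp ((∑ k, θ k * s k) - α * Real.log (M.partitionFn θ))

/-- The normalising constant of the prior: the integral of the unnormalised density against
Lebesgue measure on the space of all parameters, as an element of `[0, ∞]`. -/
def normConst (s : M.ParamIndex L → ℝ) (α : ℝ) : ℝ≥0∞ :=
  ∫⁻ θ : M.ParamIndex L → ℝ, ENNReal.ofReal (M.priorKernel s α θ)

/-- The prior is proper if its normalising constant is finite. -/
def IsProper (s : M.ParamIndex L → ℝ) (α : ℝ) : Prop :=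
  M.normConst s α < ∞

/-- The mean space of the model (for one observation): the vectors of marginal probabilities
under the cell probabilities of the model. -/
def meanSpace (L : V → Type*) [∀ γ, Fintype (L γ)] [∀ γ, DecidableEq (L γ)] [∀ γ, Zero (L γ)] :
    Set (M.ParamIndex L → ℝ) :=
  {m | ∃ θ : M.ParamIndex L → ℝ, ∀ k, m k = M.marginalProb θ k}

end

end

end HierarchicalModel

open MeasureTheory Filter Topology

/-!
The model is a finite exponential family: the logit of a cell `j` is `⟪θ, a j⟫` with `a j` the
vector of marginal indicators of `j` (`HierarchicalModel.logit_eq_dotProduct`), and the reference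
cell has `a j = 0`. Let `Z(θ) = ∑ j, exp ⟪θ, a j⟫` and `m = s / α`. Both sides of the equivalence
are shown to mean that `α > 0` and that `m` is in the interior of the convex hull of the `a j`:
for every `u ≠ 0` some `j` has `⟪u, m⟫ < ⟪u, a j⟫` (`InHullInterior`).

Under this condition `log Z(θ) - ⟪θ, m⟫ ≥ max_j ⟪θ, a j - m⟫ ≥ c ‖θ‖` with `c > 0`. Hence the kernel
`exp (-α (log Z(θ) - ⟪θ, m⟫))` is integrable, and `log Z(θ) - ⟪θ, m⟫` has a minimiser, at which the
vanishing of the gradient says that `m` is the mean (`InHullInterior.exists_eq_mean`).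

Conversely, a mean is a strictly positive average of the `a j`. These are contained in no
hyperplane, because `a j = 0` for the reference cell and the parameters are identifiable
(`HierarchicalModel.eq_zero_of_logit_eq_zero`), so such an average is interior
(`inHullInterior_of_eq_sum`). If the condition fails for some `u` while `α > 0`, the kernel does not
decrease in the direction `u`, and its integral is infinite (`lintegral_eq_top_of_le_translate`).
If `α ≤ 0`, the same holds for the lower bound `exp ⟪θ, s⟫` of the kernel.
-/

/-! ### Finite exponential families -/

section FiniteExponentialFamily

variable {ι C : Type*} [Fintype ι] [Fintype C]

/-- The partition function `∑ j, exp ⟪θ, a j⟫` of the finite exponential family with sufficient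
statistic `a : C → ι → ℝ`. -/
noncomputable def expSum (a : C → ι → ℝ) (θ : ι → ℝ) : ℝ :=
  ∑ j, Real.exp (θ ⬝ᵥ a j)

/-- The point `m` lies in the interior of the convex hull of the points `a j`, expressed without
convex hulls: every nonzero linear functional takes at some `a j` a value larger than at `m`. -/
def InHullInterior (a : C → ι → ℝ) (m : ι → ℝ) : Prop :=
  ∀ u : ι → ℝ, u ≠ 0 → ∃ j, u ⬝ᵥ m < u ⬝ᵥ a j

/-- The maximum of the functionals `⟪·, b j⟫` is positively homogeneous and, by compactness of the
unit sphere, bounded below there by a positive constant if it is positive away from `0`. -/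
theorem exists_pos_mul_norm_le_dotProduct [Nonempty ι] [Nonempty C] {b : C → ι → ℝ}
    (hb : ∀ u : ι → ℝ, u ≠ 0 → ∃ j, 0 < u ⬝ᵥ b j) :
    ∃ c > 0, ∀ u : ι → ℝ, ∃ j, c * ‖u‖ ≤ u ⬝ᵥ b j := by
  classical
  let q : (ι → ℝ) → ℝ := fun u => Finset.univ.sup' Finset.univ_nonempty fun j => u ⬝ᵥ b j
  have hq : Continuous q := by
    apply Continuous.finset_sup'_apply
    intro j _
    simp only [dotProduct]
    fun_prop
  obtain ⟨v, hv, hmin⟩ := (isCompact_sphere (0 : ι → ℝ) 1).exists_isMinOn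
    (NormedSpace.sphere_nonempty.mpr zero_le_one) hq.continuousOn
  have hv0 : v ≠ 0 := by
    rintro rfl
    simp at hv
  obtain ⟨i, hi⟩ := hb v hv0
  refine ⟨q v, hi.trans_le (Finset.le_sup' (fun j => v ⬝ᵥ b j) (Finset.mem_univ i)), fun u => ?_⟩
  rcases eq_or_ne u 0 with rfl | hu
  · exact ⟨i, by simp⟩
  have hu' : 0 < ‖u‖ := norm_pos_iff.mpr hu
  have hmem : ‖u‖⁻¹ • u ∈ Metric.sphere (0 : ι → ℝ) 1 := by
    simp [norm_smul, hu'.ne']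
  -- An index attaining the maximum at the normalised vector serves `u` too, by homogeneity.
  obtain ⟨j, -, hj⟩ := Finset.exists_mem_eq_sup' (Finset.univ_nonempty (α := C))
    fun j => (‖u‖⁻¹ • u) ⬝ᵥ b j
  refine ⟨j, ?_⟩
  have h1 : q v ≤ (‖u‖⁻¹ • u) ⬝ᵥ b j := (hmin hmem).trans_eq hj
  rw [smul_dotProduct, smul_eq_mul] at h1
  calc q v * ‖u‖ ≤ ‖u‖⁻¹ * (u ⬝ᵥ b j) * ‖u‖ := by gcongr
    _ = u ⬝ᵥ b j := by field_simp

theorem expSum_pos [Nonempty C] (a : C → ι → ℝ) (θ : ι → ℝ) : 0 < expSum a θ :=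
  Finset.sum_pos (fun _ _ => Real.exp_pos _) Finset.univ_nonempty

theorem dotProduct_le_log_expSum (a : C → ι → ℝ) (θ : ι → ℝ) (j : C) :
    θ ⬝ᵥ a j ≤ Real.log (expSum a θ) := by
  have : Nonempty C := ⟨j⟩
  rw [Real.le_log_iff_exp_le (expSum_pos a θ)]
  exact Finset.single_le_sum (f := fun j => Real.exp (θ ⬝ᵥ a j))
    (fun _ _ => (Real.exp_pos _).le) (Finset.mem_univ j)

theorem continuous_expSum (a : C → ι → ℝ) : Continuous (expSum a) := by
  unfold expSum dotProduct
  fun_prop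

theorem continuous_log_expSum_sub [Nonempty C] (a : C → ι → ℝ) (m : ι → ℝ) :
    Continuous fun θ => Real.log (expSum a θ) - θ ⬝ᵥ m := by
  refine ((continuous_expSum a).log fun θ => (expSum_pos a θ).ne').sub ?_
  unfold dotProduct
  fun_prop

/-- The negative log-likelihood `log Z(θ) - ⟪θ, m⟫` grows at least linearly, since `log Z(θ)`
dominates each `⟪θ, a j⟫`. -/
theorem InHullInterior.exists_pos_mul_norm_le [Nonempty ι] [Nonempty C] {a : C → ι → ℝ}
    {m : ι → ℝ} (h : InHullInterior a m) :
    ∃ c > 0, ∀ θ : ι → ℝ, c * ‖θ‖ ≤ Real.log (expSum a θ) - θ ⬝ᵥ m := by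
  obtain ⟨c, hc, H⟩ := exists_pos_mul_norm_le_dotProduct (b := fun j => a j - m) fun u hu => by
    obtain ⟨j, hj⟩ := h u hu
    exact ⟨j, by rw [dotProduct_sub]; linarith⟩
  refine ⟨c, hc, fun θ => ?_⟩
  obtain ⟨j, hj⟩ := H θ
  rw [dotProduct_sub] at hj
  linarith [dotProduct_le_log_expSum a θ j]

/-- Existence of the maximum likelihood estimate: the negative log-likelihood is coercive, so it
has a minimiser, and its critical points are the parameters with mean `m`. -/
theorem InHullInterior.exists_eq_mean [Nonempty ι] [Nonempty C] {a : C → ι → ℝ}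
    {m : ι → ℝ} (h : InHullInterior a m) :
    ∃ θ : ι → ℝ, ∀ k, m k = ∑ j, Real.exp (θ ⬝ᵥ a j) / expSum a θ * a j k := by
  classical
  obtain ⟨c, hc, H⟩ := h.exists_pos_mul_norm_le
  obtain ⟨θ, hθ⟩ := (continuous_log_expSum_sub a m).exists_forall_le
    (tendsto_atTop_mono H ((tendsto_norm_cocompact_atTop (E := ι → ℝ)).const_mul_atTop hc))
  refine ⟨θ, fun k => ?_⟩
  have hdot : ∀ v : ι → ℝ, HasDerivAt (fun t : ℝ => (θ + t • Pi.single k 1) ⬝ᵥ v) (v k) 0 := by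
    intro v
    simp only [add_dotProduct, smul_dotProduct, single_one_dotProduct, smul_eq_mul]
    simpa using ((hasDerivAt_id (0 : ℝ)).mul_const (v k)).const_add (θ ⬝ᵥ v)
  have hsum : HasDerivAt (fun t : ℝ => expSum a (θ + t • Pi.single k 1))
      (∑ j, Real.exp (θ ⬝ᵥ a j) * a j k) 0 := by
    unfold expSum
    refine HasDerivAt.fun_sum fun j _ => ?_
    simpa using (hdot (a j)).exp
  have hder := (hsum.log (by simpa using (expSum_pos a θ).ne')).sub (hdot m)
  have hmin : IsLocalMin ((fun t : ℝ => Real.log (expSum a (θ + t • Pi.single k 1))) -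
      fun t : ℝ => (θ + t • Pi.single k 1) ⬝ᵥ m) 0 :=
    Eventually.of_forall fun t => by
      simpa only [Pi.sub_apply, zero_smul, add_zero] using hθ (θ + t • Pi.single k 1)
  have h0 := hmin.hasDerivAt_eq_zero hder
  simp only [zero_smul, add_zero, Finset.sum_div] at h0
  rw [eq_comm, ← sub_eq_zero, ← h0]
  simp only [div_mul_eq_mul_div]

/-- A functional which is at no `a j` larger than at a strictly positive average of the `a j` has
the same value at all of them. That value is `0` because `a j₀ = 0`, and `hinj` says that only the
zero functional vanishes at all `a j`. -/
theorem inHullInterior_of_eq_sum {a : C → ι → ℝ} {m : ι → ℝ} {p : C → ℝ}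
    (hp : ∀ j, 0 < p j) (hp1 : ∑ j, p j = 1) (hm : ∀ k, m k = ∑ j, p j * a j k)
    {j₀ : C} (h₀ : a j₀ = 0) (hinj : ∀ u : ι → ℝ, (∀ j, u ⬝ᵥ a j = 0) → u = 0) :
    InHullInterior a m := by
  intro u hu
  by_contra! hle
  have hmean : u ⬝ᵥ m = ∑ j, p j * (u ⬝ᵥ a j) := by
    simp only [dotProduct, hm, Finset.mul_sum]
    rw [Finset.sum_comm]
    exact Finset.sum_congr rfl fun _ _ => Finset.sum_congr rfl fun _ _ => by ring
  have hzero : ∑ j, p j * (u ⬝ᵥ m - u ⬝ᵥ a j) = 0 := by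
    simp only [mul_sub, Finset.sum_sub_distrib, ← Finset.sum_mul, hp1, one_mul, ← hmean, sub_self]
  rw [Finset.sum_eq_zero_iff_of_nonneg
    fun j _ => mul_nonneg (hp j).le (sub_nonneg.mpr (hle j))] at hzero
  have heq : ∀ j, u ⬝ᵥ m = u ⬝ᵥ a j := fun j =>
    sub_eq_zero.mp ((mul_eq_zero.mp (hzero j (Finset.mem_univ j))).resolve_left (hp j).ne')
  refine hu (hinj u fun j => ?_)
  rw [← heq j, heq j₀, h₀, dotProduct_zero]

theorem integrable_exp_neg_mul_norm {c : ℝ} (hc : 0 < c) :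
    Integrable fun θ : ι → ℝ => Real.exp (-(c * ‖θ‖)) := by
  set n := Fintype.card ι with hn
  have hint : Integrable fun θ : ι → ℝ => (1 + ‖θ‖) ^ (-((n : ℝ) + 1)) :=
    integrable_one_add_norm (by simp [hn])
  -- Up to a constant, the exponential is dominated by the integrable function `(1 + ‖θ‖) ^ (-(n + 1))`.
  obtain ⟨K, hK⟩ : ∃ K, ∀ x : ℝ, 0 ≤ x → (1 + x) ^ (n + 1) ≤ K * Real.exp (c * x) := by
    refine ⟨(n + 1).factorial * (c⁻¹ ^ (n + 1) * Real.exp c), fun x hx => ?_⟩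
    have h1 := Real.pow_div_factorial_le_exp (c * (1 + x)) (by positivity) (n + 1)
    rw [div_le_iff₀ (by positivity), mul_pow, mul_add, mul_one, Real.exp_add] at h1
    calc (1 + x) ^ (n + 1) = c⁻¹ ^ (n + 1) * (c ^ (n + 1) * (1 + x) ^ (n + 1)) := by
          rw [← mul_assoc, ← mul_pow, inv_mul_cancel₀ hc.ne', one_pow, one_mul]
      _ ≤ c⁻¹ ^ (n + 1) * (Real.exp c * Real.exp (c * x) * (n + 1).factorial) := by gcongr
      _ = _ := by ring
  refine (hint.const_mul K).mono' (by fun_prop) (Eventually.of_forall fun θ => ?_)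
  rw [Real.norm_of_nonneg (Real.exp_pos _).le, Real.rpow_neg (by positivity), ← Nat.cast_add_one,
    Real.rpow_natCast, Real.exp_neg, inv_eq_one_div, ← div_eq_mul_inv,
    div_le_div_iff₀ (Real.exp_pos _) (by positivity), one_mul]
  exact hK _ (norm_nonneg θ)

/-- A positive function that does not decrease under translation by `u ≠ 0` has at least the same
positive integral over each of the disjoint balls of radius `‖u‖ / 2` about `0, u, 2u, …` as over
the first of them. -/
theorem lintegral_eq_top_of_le_translate {k : (ι → ℝ) → ℝ} (hk : Continuous k)
    (hpos : ∀ θ, 0 < k θ) {u : ι → ℝ} (hu : u ≠ 0) (hle : ∀ θ, k θ ≤ k (θ + u)) :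
    ∫⁻ θ, ENNReal.ofReal (k θ) = ∞ := by
  have hu' : 0 < ‖u‖ := norm_pos_iff.mpr hu
  let B : ℕ → Set (ι → ℝ) := fun n => Metric.ball (n • u) (‖u‖ / 2)
  have hle' : ∀ (n : ℕ) θ, k θ ≤ k (θ + n • u) := by
    intro n
    induction n with
    | zero => simp
    | succ n ih =>
      intro θ
      rw [succ_nsmul, ← add_assoc]
      exact (ih θ).trans (hle _)
  have hdisj : Pairwise (Function.onFun Disjoint B) := by
    intro i j hij
    apply Metric.ball_disjoint_ball
    have h1 : (1 : ℝ) ≤ |(i : ℝ) - j| := by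
      have : (1 : ℤ) ≤ |(i : ℤ) - j| := Int.one_le_abs (sub_ne_zero.mpr (by exact_mod_cast hij))
      exact_mod_cast this
    rw [dist_eq_norm, ← Nat.cast_smul_eq_nsmul ℝ, ← Nat.cast_smul_eq_nsmul ℝ, ← sub_smul,
      norm_smul, Real.norm_eq_abs]
    nlinarith
  have hmeas : Measurable fun θ => ENNReal.ofReal (k θ) := hk.measurable.ennreal_ofReal
  have hball : ∀ n, ∫⁻ θ in B 0, ENNReal.ofReal (k θ) ≤ ∫⁻ θ in B n, ENNReal.ofReal (k θ) := by
    intro n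
    have hpre : (fun θ : ι → ℝ => θ + n • u) ⁻¹' B n = B 0 := by
      ext θ
      simp [B, dist_eq_norm]
    rw [← (measurePreserving_add_right volume (n • u)).setLIntegral_comp_preimage
      (s := B n) Metric.isOpen_ball.measurableSet hmeas, hpre]
    exact lintegral_mono fun θ => ENNReal.ofReal_le_ofReal (hle' n θ)
  have hB0 : ∫⁻ θ in B 0, ENNReal.ofReal (k θ) ≠ 0 := by
    rw [Ne, setLIntegral_eq_zero_iff Metric.isOpen_ball.measurableSet hmeas]
    intro h
    have hz : volume (B 0) = 0 := by
      refine measure_mono_null ?_ h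
      intro θ hθ hh
      have := hh hθ
      rw [ENNReal.ofReal_eq_zero] at this
      exact absurd (hpos θ) this.not_gt
    exact (Metric.measure_ball_pos volume _ (half_pos hu')).ne' hz
  refine top_unique ?_
  calc ∞ = ∑' _ : ℕ, ∫⁻ θ in B 0, ENNReal.ofReal (k θ) :=
        (ENNReal.tsum_const_eq_top_of_ne_zero hB0).symm
    _ ≤ ∑' n, ∫⁻ θ in B n, ENNReal.ofReal (k θ) := ENNReal.tsum_le_tsum hball
    _ = ∫⁻ θ in ⋃ n, B n, ENNReal.ofReal (k θ) :=
      (lintegral_iUnion (fun _ => Metric.isOpen_ball.measurableSet) hdisj _).symm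
    _ ≤ ∫⁻ θ, ENNReal.ofReal (k θ) := setLIntegral_le_lintegral _ _

/-- Integrability of the Diaconis–Ylvisaker kernel of a finite exponential family. -/
theorem lintegral_exp_lt_top_iff [Nonempty ι] {a : C → ι → ℝ} {j₀ : C} (h₀ : a j₀ = 0)
    (s : ι → ℝ) (α : ℝ) :
    ∫⁻ θ : ι → ℝ, ENNReal.ofReal (Real.exp (θ ⬝ᵥ s - α * Real.log (expSum a θ))) < ∞ ↔
      0 < α ∧ InHullInterior a fun k => s k / α := by
  have : Nonempty C := ⟨j₀⟩
  have hcont : Continuous fun θ : ι → ℝ =>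
      Real.exp (θ ⬝ᵥ s - α * Real.log (expSum a θ)) := by
    refine Real.continuous_exp.comp (Continuous.sub ?_
      (((continuous_expSum a).log fun θ => (expSum_pos a θ).ne').const_mul α))
    unfold dotProduct
    fun_prop
  have hscale : 0 < α → ∀ θ : ι → ℝ, θ ⬝ᵥ s = α * (θ ⬝ᵥ fun k => s k / α) := by
    intro hα θ
    simp only [dotProduct, Finset.mul_sum]
    exact Finset.sum_congr rfl fun _ _ => by field_simp
  constructor
  · intro hfin
    have hα : 0 < α := by
      by_contra! hα
      obtain ⟨u, hu, hus⟩ : ∃ u : ι → ℝ, u ≠ 0 ∧ 0 ≤ u ⬝ᵥ s := by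
        rcases le_total 0 ((1 : ι → ℝ) ⬝ᵥ s) with h | h
        · exact ⟨1, one_ne_zero, h⟩
        · exact ⟨-1, neg_ne_zero.mpr one_ne_zero, by rw [neg_dotProduct]; linarith⟩
      have hexp : ∫⁻ θ : ι → ℝ, ENNReal.ofReal (Real.exp (θ ⬝ᵥ s)) = ∞ := by
        refine lintegral_eq_top_of_le_translate ?_ (fun _ => Real.exp_pos _) hu fun θ => ?_
        · unfold dotProduct
          fun_prop
        · rw [Real.exp_le_exp, add_dotProduct]
          linarith
      -- The term of `j₀` makes the partition function at least `1`, so for `α ≤ 0` the kernel is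
      -- bounded below by the pure exponential `exp ⟪θ, s⟫`.
      refine hfin.not_ge (hexp.symm.le.trans (lintegral_mono fun θ =>
        ENNReal.ofReal_le_ofReal (Real.exp_le_exp.mpr ?_)))
      have hlog : 0 ≤ Real.log (expSum a θ) := by
        simpa [h₀] using dotProduct_le_log_expSum a θ j₀
      nlinarith
    refine ⟨hα, fun u hu => ?_⟩
    by_contra! hle
    -- Moving in the direction `u` multiplies `Z` by at most `exp ⟪u, s / α⟫`, so the kernel does
    -- not decrease.
    refine hfin.ne (lintegral_eq_top_of_le_translate hcont (fun _ => Real.exp_pos _) hu fun θ => ?_)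
    have hZ : expSum a (θ + u) ≤ Real.exp (u ⬝ᵥ fun k => s k / α) * expSum a θ := by
      unfold expSum
      rw [Finset.mul_sum]
      gcongr with j
      rw [add_dotProduct, Real.exp_add, mul_comm]
      gcongr
      exact hle j
    have hlog := Real.log_le_log (expSum_pos a _) hZ
    rw [Real.log_mul (Real.exp_pos _).ne' (expSum_pos a θ).ne', Real.log_exp] at hlog
    rw [Real.exp_le_exp, add_dotProduct, hscale hα u]
    nlinarith
  · rintro ⟨hα, hint⟩
    obtain ⟨c, hc, H⟩ := hint.exists_pos_mul_norm_le
    refine lt_of_le_of_lt (lintegral_mono fun θ => ENNReal.ofReal_le_ofReal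
      (Real.exp_le_exp.mpr ?_)) (integrable_exp_neg_mul_norm (mul_pos hα hc)).lintegral_lt_top
    rw [hscale hα θ]
    nlinarith [H θ]

end FiniteExponentialFamily

/-! ### Hierarchical models as exponential families -/

namespace HierarchicalModel

variable {V : Type*} (M : HierarchicalModel V) {L : V → Type*} [∀ γ, DecidableEq (L γ)]
  [∀ γ, Zero (L γ)]

/-- The sufficient statistic of the model: the vector of a single observation of the cell `j`,
which has at the index `(D, i_D)` the entry `1` if `j_D = i_D`, and `0` otherwise. -/
def marginalIndicator (j : ∀ γ, L γ) (k : M.ParamIndex L) : ℝ :=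
  if ∀ γ : {γ // γ ∈ k.1.1}, j γ.1 = (k.2 γ).1 then 1 else 0

theorem marginalIndicator_zero : M.marginalIndicator (0 : ∀ γ, L γ) = 0 := by
  funext ⟨D, i⟩
  obtain ⟨γ, hγ⟩ := M.nonempty_of_mem D.1 D.2
  exact if_neg fun h => (i ⟨γ, hγ⟩).2 (h ⟨γ, hγ⟩).symm

variable [DecidableEq V]

/-- The parameters are identifiable. By induction on `D`, evaluate the logit at the cell that agrees
with `i_D` on `D` and is `0` elsewhere: it involves only `θ_E` with `E ⊆ D`, and all of these but
`θ_D(i_D)` are already known to vanish. -/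
theorem eq_zero_of_logit_eq_zero {θ : M.ParamIndex L → ℝ} (h : ∀ j, M.logit θ j = 0) :
    θ = 0 := by
  suffices H : ∀ (D : Finset V) (hD : D ∈ M.interactions) i, θ ⟨⟨D, hD⟩, i⟩ = 0 from
    funext fun ⟨⟨D, hD⟩, i⟩ => H D hD i
  intro D
  induction D using Finset.strongInduction with
  | H D ih =>
  intro hD i
  let j : ∀ γ, L γ := fun γ => if hγ : γ ∈ D then (i ⟨γ, hγ⟩).1 else 0
  have hj : ∀ γ (hγ : γ ∈ D), j γ = (i ⟨γ, hγ⟩).1 := fun γ hγ => dif_pos hγ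
  rw [← h j, logit, Finset.sum_eq_single ⟨D, hD⟩]
  · have hne : ∀ γ : {γ // γ ∈ D}, j γ.1 ≠ 0 := fun γ => by
      rw [hj γ.1 γ.2]
      exact (i γ).2
    rw [dif_pos hne]
    congr 2
    funext γ
    exact Subtype.ext (hj γ.1 γ.2).symm
  · rintro ⟨E, hE⟩ - hED
    split_ifs with hne
    · refine ih E (lt_of_le_of_ne (fun γ hγ => ?_) fun h => hED (Subtype.ext h)) hE _
      by_contra hγD
      exact hne ⟨γ, hγ⟩ (dif_neg hγD)
    · rfl
  · simp

variable [∀ γ, Fintype (L γ)]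

theorem logit_eq_dotProduct (θ : M.ParamIndex L → ℝ) (j : ∀ γ, L γ) :
    M.logit θ j = θ ⬝ᵥ M.marginalIndicator j := by
  simp only [logit, dotProduct, marginalIndicator, mul_ite, mul_one, mul_zero]
  rw [Fintype.sum_sigma]
  refine Finset.sum_congr rfl fun D _ => ?_
  split_ifs with h
  · rw [Finset.sum_eq_single (fun γ => ⟨j γ.1, h γ⟩)]
    · simp
    · intro i _ hi
      refine if_neg fun hj => hi ?_
      funext γ
      exact Subtype.ext (hj γ).symm
    · simp
  · refine (Finset.sum_eq_zero fun i _ => if_neg fun hj => h fun γ => ?_).symm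
    rw [hj γ]
    exact (i γ).2

variable [Fintype V]

theorem partitionFn_eq_expSum (θ : M.ParamIndex L → ℝ) :
    M.partitionFn θ = expSum M.marginalIndicator θ := by
  have h0 : (Finset.univ.filter fun i : ∀ γ, L γ => i ≠ 0) = Finset.univ.erase 0 := by
    ext
    simp
  simp only [partitionFn, logit_eq_dotProduct, expSum, h0]
  rw [← Finset.add_sum_erase _ _ (Finset.mem_univ (0 : ∀ γ, L γ)), marginalIndicator_zero,
    dotProduct_zero, Real.exp_zero]

theorem marginalProb_eq_sum (θ : M.ParamIndex L → ℝ) (k : M.ParamIndex L) :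
    M.marginalProb θ k = ∑ j, Real.exp (θ ⬝ᵥ M.marginalIndicator j) /
      expSum M.marginalIndicator θ * M.marginalIndicator j k := by
  simp only [marginalProb, cellProb, logit_eq_dotProduct, partitionFn_eq_expSum,
    Finset.sum_filter]
  refine Finset.sum_congr rfl fun j _ => ?_
  rw [marginalIndicator, mul_ite, mul_one, mul_zero]

end HierarchicalModel

open HierarchicalModel in
theorem lemma3p1 {V : Type*} [Fintype V] [DecidableEq V] (M : HierarchicalModel V)
    (L : V → Type*) [∀ γ, Fintype (L γ)] [∀ γ, DecidableEq (L γ)] [∀ γ, Zero (L γ)]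
    [Nonempty (M.ParamIndex L)] (s : M.ParamIndex L → ℝ) (α : ℝ) :
    M.IsProper s α ↔ 0 < α ∧ (fun k => s k / α) ∈ M.meanSpace L := by
  have hproper := lintegral_exp_lt_top_iff M.marginalIndicator_zero s α
  simp only [IsProper, normConst, priorKernel, partitionFn_eq_expSum]
  refine hproper.trans (and_congr_right fun _ => ⟨fun h => ?_, ?_⟩)
  · obtain ⟨θ, hθ⟩ := h.exists_eq_mean
    exact ⟨θ, fun k => (hθ k).trans (M.marginalProb_eq_sum θ k).symm⟩
  · rintro ⟨θ, hθ⟩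
    refine inHullInterior_of_eq_sum
      (fun j => div_pos (Real.exp_pos _) (expSum_pos M.marginalIndicator θ)) ?_
      (fun k => (hθ k).trans (M.marginalProb_eq_sum θ k)) M.marginalIndicator_zero
      fun u hu => M.eq_zero_of_logit_eq_zero fun j => (M.logit_eq_dotProduct u j).trans (hu j)
    rw [← Finset.sum_div]
    exact div_self (expSum_pos M.marginalIndicator θ).ne'
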